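/- Let $G$ be a finite simple graph whose vertex set $V(G)$ is linearly ordered (for instance $V(G)=\{1,\ldots,n\}$), and let $\Sigma=(\sigma_1,\ldots,\sigma_s)$ be a finite collection of cliques of $G$, possibly repeated and not necessarily of the same size; put $|\Sigma|=s$. The Dani–Mainkar Lie algebra $\mathcal L(G)$ is the real Lie algebra with basis $x_i$ ($i\in V(G)$) and $x_{i,j}$ ($i<j$, $\{i,j\}\in E(G)$) in which, up to skew-symmetry, the only nonzero brackets of basis vectors are $[x_i,x_j]=x_{i,j}$ for $i<j$, $\{i,j\}\in E(G)$. The Grantcharov–Grantcharov–Iliev Lie algebra $\mathcal L(G,\Sigma)$ is the real Lie algebra with basis $x_i$ ($i\in V(G)$), $x_{i,j}$ ($i<j$, $\{i,j\}\in E(G)$) and $y_1,\ldots,y_s$ in which, up to skew-symmetry, the only nonzero brackets of basis vectors are $$[x_i,x_j]=x_{i,j},\qquad [x_i,y_k]=|\{i\}\cap\sigma_k|\,x_i,\qquad [x_{i,j},y_k]=|\{i,j\}\cap\sigma_k|\,x_{i,j}$$ for $i<j$ with $\{i,j\}\in E(G)$ in the first and third formulas, $i\in V(G)$ in the second, and $1\le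 k\le s$. For a real Lie algebra $L$ let $H^k(L)$ be the $k$-th cohomology of its Cartan–Chevalley–Eilenberg complex $\Lambda^\bullet L^*$ with trivial real coefficients. Theorem. Let $\widetilde G$ be the subgraph of $G$ induced by the vertices that belong to no clique of $\Sigma$, and let $\widetilde G+|\Sigma|K_1$ be its disjoint union with $|\Sigma|$ isolated vertices. Then for all $k\ge 0$ there is an isomorphism of real vector spaces $$H^k(\mathcal L(G,\Sigma))\;\cong\; H^k(\mathcal L(\widetilde G+|\Sigma|K_1)).$$ -/

import Mathlib

set_option maxSynthPendingDepth 3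

/-! ## The Cartan-Chevalley-Eilenberg complex of a real Lie algebra (trivial coefficients) -/

namespace ChevalleyEilenberg

open AlternatingMap

variable (L : Type*) [LieRing L] [LieAlgebra ℝ L]

/-- The space `C^k(L) = Λ^k L*` of `k`-cochains: alternating `k`-linear forms on `L`. -/
abbrev Cochain (k : ℕ) : Type _ := L [⋀^Fin k]→ₗ[ℝ] ℝ

variable {L}

/-- The bilinear map `(x, y) ↦ ω(⁅x, y⁆, -, …, -)`. -/
noncomputable def insertBracket {n : ℕ} (ω : Cochain L (n + 1)) : L →ₗ[ℝ] L →ₗ[ℝ] Cochain L n :=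
  LinearMap.mk₂ ℝ (fun x y => ω.curryLeft ⁅x, y⁆)
    (fun x x' y => by rw [add_lie, map_add]) (fun c x y => by rw [smul_lie, map_smul])
    (fun x y y' => by rw [lie_add, map_add]) (fun c x y => by rw [lie_smul, map_smul])

variable (L)

/-- The Cartan-Chevalley-Eilenberg differential `d : C^k(L) → C^{k+1}(L)`. It vanishes on `C^0(L)`;
in positive degree it is minus one half of the full skew-symmetrization of
`(x, y) ↦ ω(⁅x, y⁆, -, …, -)`, which is the usual formula
`dω(v_0, …, v_k) = ∑_{i < j} (-1)^{i+j} ω(⁅v_i, v_j⁆, v_0, …, v̂_i, …, v̂_j, …, v_k)`;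
see `d_succ_apply`. -/
noncomputable def d : (k : ℕ) → Cochain L k →ₗ[ℝ] Cochain L (k + 1)
  | 0 => 0
  | n + 1 =>
    { toFun := fun ω => (-(1 / 2) : ℝ) •
        alternatizeUncurryFin (alternatizeUncurryFinLM ∘ₗ insertBracket (n := n) ω)
      map_add' := fun ω η => by
        have h : insertBracket (ω + η) = insertBracket ω + insertBracket η := by
          ext; simp [insertBracket]
        rw [h, LinearMap.comp_add, alternatizeUncurryFin_add, smul_add]
      map_smul' := fun c ω => by
        have h : insertBracket (c • ω) = c • insertBracket ω := by
          ext; simp [insertBracket]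
        rw [h, LinearMap.comp_smul, alternatizeUncurryFin_smul, smul_comm, RingHom.id_apply] }

variable {L}

/-- The usual formula for the differential. A pair `i < j` in `{0, …, n + 1}` is written as
`(i.castSucc, j.succ)` with `i ≤ j` in `Fin (n + 1)`, which accounts for the minus sign. -/
theorem d_succ_apply {n : ℕ} (ω : Cochain L (n + 1)) (v : Fin (n + 2) → L) :
    d L (n + 1) ω v = -∑ i : Fin (n + 1), ∑ j ≥ i, (-1 : ℝ) ^ (i + j : ℕ) *
      ω (Matrix.vecCons ⁅v i.castSucc, v j.succ⁆ (j.removeNth (i.castSucc.removeNth v))) := by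
  change (-(1 / 2) : ℝ) • alternatizeUncurryFin (alternatizeUncurryFinLM ∘ₗ insertBracket ω) v = _
  rw [alternatizeUncurryFin_alternatizeUncurryFinLM_comp_apply, Finset.smul_sum,
    ← Finset.sum_neg_distrib]
  refine Finset.sum_congr rfl fun i _ => ?_
  rw [Finset.smul_sum, ← Finset.sum_neg_distrib]
  refine Finset.sum_congr rfl fun j _ => ?_
  have h : insertBracket ω (v j.succ) (v i.castSucc) =
      - insertBracket ω (v i.castSucc) (v j.succ) := by
    simp only [insertBracket, LinearMap.mk₂_apply]
    rw [← lie_skew, map_neg]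
  rw [h]
  simp only [insertBracket, LinearMap.mk₂_apply, curryLeft_apply_apply,
    AlternatingMap.neg_apply, zsmul_eq_mul, smul_eq_mul]
  push_cast
  ring

variable (L)

/-- The space `B^k(L)` of coboundaries. -/
noncomputable def coboundaries : (k : ℕ) → Submodule ℝ (Cochain L k)
  | 0 => ⊥
  | k + 1 => LinearMap.range (d L k)

/-- The space `Z^k(L)` of cocycles. -/
noncomputable def cocycles (k : ℕ) : Submodule ℝ (Cochain L k) := LinearMap.ker (d L k)

/-- The cohomology `H^k(L) = Z^k(L) / B^k(L)` (`B^k(L)` lies in `Z^k(L)`, as `d ∘ d = 0`). -/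
abbrev Cohomology (k : ℕ) : Type _ :=
  cocycles L k ⧸ (coboundaries L k).submoduleOf (cocycles L k)

end ChevalleyEilenberg

/-! ## Lie algebras attached to graphs

A finite simple graph `G` has a (finite) linearly ordered vertex set `V`. -/

namespace GraphLie

variable {V : Type*} [LinearOrder V]

/-- The edges of `G`, each one written once, as a pair `(i, j)` with `i < j`. -/
abbrev Edge (G : SimpleGraph V) : Type _ := {e : V × V // e.1 < e.2 ∧ G.Adj e.1 e.2}

/-- The Dani-Mainkar Lie algebra `𝓛(G)`: the real vector space with basis `x_i` (`i` a vertex) and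
`x_{i,j}` (`i < j` adjacent), given here by coordinates. Its only nonzero brackets of basis vectors
are `⁅x_i, x_j⁆ = x_{i,j}` and `⁅x_j, x_i⁆ = -x_{i,j}` for `i < j` adjacent. -/
def DaniMainkar (G : SimpleGraph V) : Type _ := (V → ℝ) × (Edge G → ℝ)

namespace DaniMainkar

variable (G : SimpleGraph V)

noncomputable instance : AddCommGroup (DaniMainkar G) :=
  inferInstanceAs (AddCommGroup ((V → ℝ) × (Edge G → ℝ)))

noncomputable instance : Module ℝ (DaniMainkar G) :=
  inferInstanceAs (Module ℝ ((V → ℝ) × (Edge G → ℝ)))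

noncomputable instance : Bracket (DaniMainkar G) (DaniMainkar G) where
  bracket a b := ((fun _ => 0, fun e => a.1 e.1.1 * b.1 e.1.2 - a.1 e.1.2 * b.1 e.1.1) :
    (V → ℝ) × (Edge G → ℝ))

noncomputable instance : LieRing (DaniMainkar G) where
  add_lie a b c := Prod.ext (funext fun _ => (add_zero (0 : ℝ)).symm) (funext fun e => by
    change (a.1 _ + b.1 _) * c.1 _ - (a.1 _ + b.1 _) * c.1 _ =
      (a.1 _ * c.1 _ - a.1 _ * c.1 _) + (b.1 _ * c.1 _ - b.1 _ * c.1 _)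
    ring)
  lie_add a b c := Prod.ext (funext fun _ => (add_zero (0 : ℝ)).symm) (funext fun e => by
    change a.1 _ * (b.1 _ + c.1 _) - a.1 _ * (b.1 _ + c.1 _) =
      (a.1 _ * b.1 _ - a.1 _ * b.1 _) + (a.1 _ * c.1 _ - a.1 _ * c.1 _)
    ring)
  lie_self a := Prod.ext rfl (funext fun e => by
    change a.1 _ * a.1 _ - a.1 _ * a.1 _ = 0
    ring)
  leibniz_lie a b c := Prod.ext (funext fun _ => (add_zero (0 : ℝ)).symm) (funext fun e => by
    change a.1 _ * 0 - a.1 _ * 0 = (0 * c.1 _ - 0 * c.1 _) + (b.1 _ * 0 - b.1 _ * 0)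
    ring)

noncomputable instance : LieAlgebra ℝ (DaniMainkar G) where
  lie_smul t a b := Prod.ext (funext fun _ => (mul_zero t).symm) (funext fun e => by
    change a.1 _ * (t * b.1 _) - a.1 _ * (t * b.1 _) = t * (a.1 _ * b.1 _ - a.1 _ * b.1 _)
    ring)

end DaniMainkar

variable {s : ℕ}

/-- The Grantcharov-Grantcharov-Iliev Lie algebra `𝓛(G, Σ)` of a finite graph `G` and a finite
family `σ_1, …, σ_s` of (possibly repeated) vertex sets, which will be cliques of `G`: the real
vector space with basis `x_i` (`i` a vertex), `x_{i,j}` (`i < j` adjacent) and `y_k` (`k ≤ s`),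
given here by coordinates. Its only nonzero brackets of basis vectors are, up to skew-symmetry,
`⁅x_i, x_j⁆ = x_{i,j}` for `i < j` adjacent, `⁅x_i, y_k⁆ = |{i} ∩ σ_k| x_i` and
`⁅x_{i,j}, y_k⁆ = |{i, j} ∩ σ_k| x_{i,j}`. -/
@[nolint unusedArguments]
def GGI (G : SimpleGraph V) (_σ : Fin s → Finset V) : Type _ :=
  (V → ℝ) × (Edge G → ℝ) × (Fin s → ℝ)

namespace GGI

variable (G : SimpleGraph V) (σ : Fin s → Finset V)

noncomputable instance : AddCommGroup (GGI G σ) :=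
  inferInstanceAs (AddCommGroup ((V → ℝ) × (Edge G → ℝ) × (Fin s → ℝ)))

noncomputable instance : Module ℝ (GGI G σ) :=
  inferInstanceAs (Module ℝ ((V → ℝ) × (Edge G → ℝ) × (Fin s → ℝ)))

variable {G σ}

/-- The coordinate of `a` at the basis vector `x_i`. -/
def x (a : GGI G σ) (i : V) : ℝ := a.1 i

/-- The coordinate of `a` at the basis vector `x_e`, for an edge `e`. -/
def xe (a : GGI G σ) (e : Edge G) : ℝ := a.2.1 e

/-- The coordinate of `a` at the basis vector `y_k`. -/
def y (a : GGI G σ) (k : Fin s) : ℝ := a.2.2 k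

variable (G σ)

noncomputable instance : Bracket (GGI G σ) (GGI G σ) where
  bracket a b :=
    ((fun i => ∑ k, ((({i} : Finset V) ∩ σ k).card : ℝ) * (a.x i * b.y k - a.y k * b.x i),
      fun e => a.x e.1.1 * b.x e.1.2 - a.x e.1.2 * b.x e.1.1 +
        ∑ k, ((({e.1.1, e.1.2} : Finset V) ∩ σ k).card : ℝ) * (a.xe e * b.y k - a.y k * b.xe e),
      fun _ => 0) : (V → ℝ) × (Edge G → ℝ) × (Fin s → ℝ))

variable {G σ}

theorem ext' {a b : GGI G σ} (h₁ : ∀ i, a.x i = b.x i) (h₂ : ∀ e, a.xe e = b.xe e)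
    (h₃ : ∀ k, a.y k = b.y k) : a = b :=
  Prod.ext (funext h₁) (Prod.ext (funext h₂) (funext h₃))

theorem x_add (a b : GGI G σ) (i : V) : (a + b).x i = a.x i + b.x i := rfl
theorem xe_add (a b : GGI G σ) (e : Edge G) : (a + b).xe e = a.xe e + b.xe e := rfl
theorem y_add (a b : GGI G σ) (k : Fin s) : (a + b).y k = a.y k + b.y k := rfl
theorem x_zero (i : V) : (0 : GGI G σ).x i = 0 := rfl
theorem xe_zero (e : Edge G) : (0 : GGI G σ).xe e = 0 := rfl
theorem y_zero (k : Fin s) : (0 : GGI G σ).y k = 0 := rfl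
theorem x_smul (t : ℝ) (a : GGI G σ) (i : V) : (t • a).x i = t * a.x i := rfl
theorem xe_smul (t : ℝ) (a : GGI G σ) (e : Edge G) : (t • a).xe e = t * a.xe e := rfl
theorem y_smul (t : ℝ) (a : GGI G σ) (k : Fin s) : (t • a).y k = t * a.y k := rfl

theorem x_lie (a b : GGI G σ) (i : V) : (⁅a, b⁆ : GGI G σ).x i =
    ∑ k, ((({i} : Finset V) ∩ σ k).card : ℝ) * (a.x i * b.y k - a.y k * b.x i) := rfl

theorem xe_lie (a b : GGI G σ) (e : Edge G) : (⁅a, b⁆ : GGI G σ).xe e =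
    a.x e.1.1 * b.x e.1.2 - a.x e.1.2 * b.x e.1.1 +
      ∑ k, ((({e.1.1, e.1.2} : Finset V) ∩ σ k).card : ℝ) *
        (a.xe e * b.y k - a.y k * b.xe e) := rfl

theorem y_lie (a b : GGI G σ) (k : Fin s) : (⁅a, b⁆ : GGI G σ).y k = 0 := rfl

/-- `|{i, j} ∩ σ_k| = |{i} ∩ σ_k| + |{j} ∩ σ_k|` for `i ≠ j`. -/
theorem card_pair_inter {i j : V} (h : i ≠ j) (t : Finset V) :
    ((({i, j} : Finset V) ∩ t).card : ℝ) =
      (({i} : Finset V) ∩ t).card + (({j} : Finset V) ∩ t).card := by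
  rw [Finset.insert_eq, Finset.union_inter_distrib_right, Finset.card_union_of_disjoint]
  · push_cast; rfl
  · exact Finset.disjoint_of_subset_left Finset.inter_subset_left
      (Finset.disjoint_of_subset_right Finset.inter_subset_left (by simpa using h))

/-- The sum `∑_k |t ∩ σ_k| y_k`, through which the brackets are computed. -/
noncomputable def wt (t : Finset V) (a : GGI G σ) : ℝ := ∑ k, ((t ∩ σ k).card : ℝ) * a.y k

theorem wt_add (t : Finset V) (a b : GGI G σ) : wt t (a + b) = wt t a + wt t b := by
  simp only [wt, y_add, mul_add, Finset.sum_add_distrib]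

theorem wt_smul (t : Finset V) (r : ℝ) (a : GGI G σ) : wt t (r • a) = r * wt t a := by
  simp only [wt, y_smul, Finset.mul_sum, mul_left_comm]

theorem wt_lie (t : Finset V) (a b : GGI G σ) : wt t ⁅a, b⁆ = 0 := by
  simp only [wt, y_lie, mul_zero, Finset.sum_const_zero]

theorem wt_pair {i j : V} (h : i ≠ j) (a : GGI G σ) : wt {i, j} a = wt {i} a + wt {j} a := by
  simp only [wt, card_pair_inter h, add_mul, Finset.sum_add_distrib]

theorem sum_weight (t : Finset V) (a b : GGI G σ) (u v : ℝ) :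
    ∑ k, ((t ∩ σ k).card : ℝ) * (u * b.y k - a.y k * v) = u * wt t b - wt t a * v := by
  rw [wt, wt, Finset.mul_sum, Finset.sum_mul, ← Finset.sum_sub_distrib]
  exact Finset.sum_congr rfl fun k _ => by ring

noncomputable instance : LieRing (GGI G σ) where
  add_lie a b c := ext'
    (fun i => by simp only [x_lie, x_add, sum_weight, wt_add]; ring)
    (fun e => by simp only [xe_lie, xe_add, x_add, sum_weight, wt_add]; ring)
    (fun k => by simp only [y_lie, y_add, add_zero])
  lie_add a b c := ext'
    (fun i => by simp only [x_lie, x_add, sum_weight, wt_add]; ring)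
    (fun e => by simp only [xe_lie, xe_add, x_add, sum_weight, wt_add]; ring)
    (fun k => by simp only [y_lie, y_add, add_zero])
  lie_self a := ext'
    (fun i => by rw [x_lie, sum_weight, x_zero]; ring)
    (fun e => by rw [xe_lie, sum_weight, xe_zero]; ring)
    (fun k => rfl)
  leibniz_lie a b c := ext'
    (fun i => by simp only [x_lie, x_add, sum_weight, wt_lie]; ring)
    (fun e => by
      simp only [xe_lie, xe_add, x_lie, sum_weight, wt_lie, wt_pair e.2.1.ne]
      ring)
    (fun k => by simp only [y_lie, y_add, add_zero])

noncomputable instance : LieAlgebra ℝ (GGI G σ) where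
  lie_smul t a b := ext'
    (fun i => by simp only [x_lie, x_smul, sum_weight, wt_smul]; ring)
    (fun e => by simp only [xe_lie, xe_smul, x_smul, sum_weight, wt_smul]; ring)
    (fun k => by simp only [y_lie, y_smul, mul_zero])

end GGI

/-- `G + m K_1`: the disjoint union of `G` with `m` isolated vertices. The new vertices are put
after those of `G` in the linear order. -/
def addIsolated (G : SimpleGraph V) (m : ℕ) : SimpleGraph (V ⊕ₗ Fin m) :=
  (G ⊕g (⊥ : SimpleGraph (Fin m))).comap ofLex

end GraphLie

/-! The element `y = -∑ y_k` acts diagonally on the standard basis: its eigenvalue is the number of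
cliques containing `i` on `x_i`, the sum of the two such numbers on `x_{i,j}`, and zero on `y_k`.
The Lie derivative along `y` is null-homotopic by Cartan's formula, and it multiplies a cochain of
weight `λ` by `-λ`, so only cochains of weight zero contribute to cohomology. Since no eigenvalue is
negative, a sum of eigenvalues vanishes only if every term does; hence these cochains live on the
zero eigenspace. That eigenspace is spanned by the uncovered `x_i`, the `x_{i,j}` with both ends
uncovered, and the `y_k`, which are central in it: it is the Dani-Mainkar algebra of the reduced
graph.

The projection `toReduced` and the inclusion `ofReduced` are Lie homomorphisms. One composite is the
identity; `sub_pullback_mem_coboundaries` shows that the other induces the identity on cohomology,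
and `nonempty_cohomology_equiv` concludes. -/

namespace ChevalleyEilenberg

variable {L L' : Type*} [LieRing L] [LieAlgebra ℝ L] [LieRing L'] [LieAlgebra ℝ L']

/-! ### Functoriality of cohomology -/

/-- The pullback of cochains along a homomorphism of Lie algebras. -/
noncomputable def pullback (f : L' →ₗ⁅ℝ⁆ L) (k : ℕ) : Cochain L k →ₗ[ℝ] Cochain L' k where
  toFun ω := ω.compLinearMap (f : L' →ₗ[ℝ] L)
  map_add' _ _ := rfl
  map_smul' _ _ := rfl

theorem pullback_apply (f : L' →ₗ⁅ℝ⁆ L) {k : ℕ} (ω : Cochain L k) (v : Fin k → L') :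
    pullback f k ω v = ω (fun i => f (v i)) := rfl

theorem d_pullback (f : L' →ₗ⁅ℝ⁆ L) {k : ℕ} (ω : Cochain L k) :
    d L' k (pullback f k ω) = pullback f (k + 1) (d L k ω) := by
  cases k with
  | zero => simp [d]
  | succ n =>
    ext v
    rw [pullback_apply, d_succ_apply, d_succ_apply]
    simp only [pullback_apply]
    refine congrArg Neg.neg (Finset.sum_congr rfl fun i _ => Finset.sum_congr rfl fun j _ => ?_)
    congr 2
    funext l
    refine Fin.cases ?_ (fun l => ?_) l
    · simp
    · simp [Fin.removeNth]

theorem pullback_mem_cocycles (f : L' →ₗ⁅ℝ⁆ L) {k : ℕ} {ω : Cochain L k}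
    (h : ω ∈ cocycles L k) : pullback f k ω ∈ cocycles L' k := by
  rw [cocycles, LinearMap.mem_ker] at h ⊢
  rw [d_pullback, h, map_zero]

theorem pullback_mem_coboundaries (f : L' →ₗ⁅ℝ⁆ L) {k : ℕ} {ω : Cochain L k}
    (h : ω ∈ coboundaries L k) : pullback f k ω ∈ coboundaries L' k := by
  cases k with
  | zero =>
    rw [coboundaries, Submodule.mem_bot] at h ⊢
    rw [h, map_zero]
  | succ n =>
    obtain ⟨η, rfl⟩ := h
    exact ⟨pullback f n η, d_pullback f η⟩

/-- The map induced in cohomology by a homomorphism of Lie algebras. -/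
noncomputable def cohomologyMap (f : L' →ₗ⁅ℝ⁆ L) (k : ℕ) : Cohomology L k →ₗ[ℝ] Cohomology L' k :=
  Submodule.mapQ _ _ ((pullback f k).restrict fun _ h => pullback_mem_cocycles f h)
    fun _ h => pullback_mem_coboundaries f h

/-! ### Cartan's formula on eigenvectors -/

/-- The interior product with `y`. -/
noncomputable def contract (y : L) (n : ℕ) : Cochain L (n + 1) →ₗ[ℝ] Cochain L n where
  toFun ω := ω.curryLeft y
  map_add' _ _ := rfl
  map_smul' _ _ := rfl

theorem contract_apply (y : L) {n : ℕ} (ω : Cochain L (n + 1)) (v : Fin n → L) :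
    contract y n ω v = ω (Matrix.vecCons y v) := rfl

/-- The Lie derivative along `y` in positive degree, defined by Cartan's formula. -/
noncomputable def lieDerivative (y : L) (n : ℕ) : Cochain L (n + 1) →ₗ[ℝ] Cochain L (n + 1) :=
  contract y (n + 1) ∘ₗ d L (n + 1) + d L n ∘ₗ contract y n

/-- Moving the entry `v j` from the front back to its own slot costs `(-1) ^ j`, which cancels the
sign in the sum. -/
theorem sum_contract_terms (y : L) {n : ℕ} (ω : Cochain L (n + 1)) (v : Fin (n + 1) → L)
    (m : Fin (n + 1) → ℝ) (hv : ∀ i, ⁅y, v i⁆ = m i • v i) :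
    ∑ j : Fin (n + 1), (-1 : ℝ) ^ (j : ℕ) * ω (Matrix.vecCons ⁅y, v j⁆ (j.removeNth v)) =
      (∑ j, m j) * ω v := by
  rw [Finset.sum_mul]
  refine Finset.sum_congr rfl fun j _ => ?_
  have h := ω.neg_one_pow_smul_map_insertNth j (v j) (j.removeNth v)
  rw [Fin.insertNth_self_removeNth] at h
  rw [hv, AlternatingMap.map_vecCons_smul, ← h, smul_eq_mul, zsmul_eq_mul]
  push_cast
  rw [mul_left_comm, ← mul_assoc ((-1 : ℝ) ^ (j : ℕ)), ← mul_pow]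
  simp

theorem map_vecCons_vecCons_swap {n : ℕ} (ω : Cochain L (n + 2)) (a b : L) (v : Fin n → L) :
    -ω (Matrix.vecCons b (Matrix.vecCons a v)) = ω (Matrix.vecCons a (Matrix.vecCons b v)) := by
  rw [← ω.map_swap _ (i := 0) (j := 1) (by simp)]
  congr 1
  funext l
  refine Fin.cases (by simp) (fun l => Fin.cases (by simp) (fun l => ?_) l) l
  have h : Equiv.swap (0 : Fin (n + 2)) 1 l.succ.succ = l.succ.succ :=
    Equiv.swap_apply_of_ne_of_ne (Fin.succ_ne_zero _)
      (fun h => Fin.succ_ne_zero _ (Fin.succ_injective _ h))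
  simp [h]

/-- Cartan's formula, evaluated at eigenvectors of `ad y`. -/
theorem lieDerivative_apply_of_eigen (y : L) {n : ℕ} (ω : Cochain L (n + 1))
    (v : Fin (n + 1) → L) (m : Fin (n + 1) → ℝ) (hv : ∀ i, ⁅y, v i⁆ = m i • v i) :
    lieDerivative y n ω v = -((∑ i, m i) * ω v) := by
  have h1 : lieDerivative y n ω v =
      d L (n + 1) ω (Matrix.vecCons y v) + d L n (contract y n ω) v := rfl
  -- The pairs containing the slot of `y` give the main term; the remaining pairs must cancel
  -- against `d` of the contraction.
  rw [h1, d_succ_apply, Fin.sum_univ_succ, ← sum_contract_terms y ω v m hv]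
  have h2 : (Finset.univ.filter fun j : Fin (n + 1) => j ≥ 0) = Finset.univ := by
    ext; simp
  have h3 : ∑ j ≥ (0 : Fin (n + 1)), (-1 : ℝ) ^ (((0 : Fin (n + 1)) : ℕ) + j : ℕ) *
      ω (Matrix.vecCons ⁅Matrix.vecCons y v (Fin.castSucc 0), Matrix.vecCons y v j.succ⁆
        (j.removeNth ((Fin.castSucc 0).removeNth (Matrix.vecCons y v)))) =
      ∑ j : Fin (n + 1), (-1 : ℝ) ^ (j : ℕ) * ω (Matrix.vecCons ⁅y, v j⁆ (j.removeNth v)) := by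
    refine Finset.sum_congr (by ext; simp) fun j _ => ?_
    simp [Matrix.vecCons]
  rw [h3, neg_add, add_assoc]
  refine add_eq_left.2 ?_
  cases n with
  | zero => simp [d]
  | succ n =>
    rw [d_succ_apply, ← neg_add, neg_eq_zero, ← Finset.sum_add_distrib]
    refine Finset.sum_eq_zero fun i _ => ?_
    -- Shifting both indices by one preserves the sign `(-1) ^ (i + j)`, so the minus sign from
    -- exchanging `y` with the bracket makes the terms cancel in pairs.
    have h4 : Finset.Ici i.succ = (Finset.Ici i).map (Fin.succEmb (n + 1)) := by
      ext j
      refine Fin.cases ?_ (fun j => ?_) j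
      · simp
      · simp
    change ∑ j ∈ Finset.Ici i.succ, _ + ∑ j ∈ Finset.Ici i, _ = (0 : ℝ)
    rw [h4, Finset.sum_map, ← Finset.sum_add_distrib]
    refine Finset.sum_eq_zero fun j _ => ?_
    rw [contract_apply, ← map_vecCons_vecCons_swap]
    have h5 : (Fin.succEmb (n + 1) j).removeNth
        (i.succ.castSucc.removeNth (Matrix.vecCons y v)) =
        Matrix.vecCons y (j.removeNth (i.castSucc.removeNth v)) := by
      funext l
      refine Fin.cases ?_ (fun l => ?_) l
      · simp [Fin.removeNth]
      · simp [Fin.removeNth]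
    rw [h5]
    simp only [Fin.val_succ, Fin.coe_succEmb, ← Fin.succ_castSucc, Matrix.cons_val_succ]
    ring

/-- By the Leibniz rule `⁅v_i, v_j⁆` is an eigenvector for `m i + m j`, so every term of `d` has the
same total weight `∑ m`. -/
theorem d_lieDerivative_apply_of_eigen (y : L) {n : ℕ} (ω : Cochain L (n + 1))
    (v : Fin (n + 2) → L) (m : Fin (n + 2) → ℝ) (hv : ∀ i, ⁅y, v i⁆ = m i • v i) :
    d L (n + 1) (lieDerivative y n ω) v = -((∑ i, m i) * d L (n + 1) ω v) := by
  rw [d_succ_apply, d_succ_apply, mul_neg, Finset.mul_sum]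
  rw [neg_neg, ← Finset.sum_neg_distrib]
  refine Finset.sum_congr rfl fun i _ => ?_
  rw [Finset.mul_sum, ← Finset.sum_neg_distrib]
  refine Finset.sum_congr rfl fun j hj => ?_
  rw [lieDerivative_apply_of_eigen y ω _
    (Matrix.vecCons (m i.castSucc + m j.succ) (j.removeNth (i.castSucc.removeNth m)))]
  -- For `i ≤ j`, deleting slot `i.castSucc` and then slot `j` deletes the original slot `j.succ`.
  · have hij : i.castSucc.succAbove j = j.succ :=
      Fin.succAbove_of_le_castSucc _ _ (Fin.castSucc_le_castSucc_iff.2 (by simpa using hj))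
    have hs : ∑ l, Matrix.vecCons (m i.castSucc + m j.succ)
        (j.removeNth (i.castSucc.removeNth m)) l = ∑ l, m l := by
      rw [Fin.sum_univ_succ, Fin.sum_univ_succAbove m i.castSucc, Fin.sum_univ_succAbove _ j, hij]
      simp [Fin.removeNth, add_assoc]
    rw [hs]
    ring
  · refine Fin.cases ?_ fun l => ?_
    · simp only [Matrix.cons_val_zero]
      rw [leibniz_lie, hv, hv, smul_lie, lie_smul, add_smul]
    · simp only [Matrix.cons_val_succ, Fin.removeNth_apply, hv]

/-! ### Reduction to the zero eigenspace -/

variable {ι : Type*}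

theorem ext_basis (b : Module.Basis ι ℝ L) {k : ℕ} {ω η : Cochain L k}
    (h : ∀ v : Fin k → ι, ω (fun i => b (v i)) = η (fun i => b (v i))) : ω = η :=
  b.ext_alternating fun v _ => h v

theorem finite_cochain [Finite ι] (b : Module.Basis ι ℝ L) (k : ℕ) :
    Module.Finite ℝ (Cochain L k) := by
  have := Module.Finite.of_basis b
  have := Module.Free.of_basis b
  exact Module.Finite.of_injective
    (AlternatingMap.toMultilinearMapLM (R := ℝ) (S := ℝ) (M := L) (N := ℝ) (ι := Fin k))
    AlternatingMap.coe_multilinearMap_injective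

/-- Weight by weight, the Lie derivative commutes with `d`; this avoids any appeal to `d ∘ d = 0`.
-/
theorem lieDerivative_mem_cocycles (b : Module.Basis ι ℝ L) (y : L) (m : ι → ℝ)
    (hb : ∀ i, ⁅y, b i⁆ = m i • b i) {n : ℕ} {ω : Cochain L (n + 1)}
    (h : ω ∈ cocycles L (n + 1)) : lieDerivative y n ω ∈ cocycles L (n + 1) := by
  rw [cocycles, LinearMap.mem_ker] at h ⊢
  refine ext_basis b fun v => ?_
  rw [d_lieDerivative_apply_of_eigen y ω _ (fun i => m (v i)) fun i => hb _, h]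
  simp

theorem lieDerivative_mem_coboundaries (y : L) {n : ℕ} {ω : Cochain L (n + 1)}
    (h : ω ∈ cocycles L (n + 1)) : lieDerivative y n ω ∈ coboundaries L (n + 1) := by
  rw [cocycles, LinearMap.mem_ker] at h
  refine ⟨contract y n ω, ?_⟩
  simp [lieDerivative, h]

/-- If `ad y` is diagonal with nonnegative eigenvalues `m i` and the endomorphism `π` is the
projection onto its kernel, then a cocycle is cohomologous to its pullback along `π`. -/
theorem sub_pullback_mem_coboundaries [Finite ι]
    (b : Module.Basis ι ℝ L) (y : L) (m : ι → ℝ)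
    (hm : ∀ i, 0 ≤ m i) (hb : ∀ i, ⁅y, b i⁆ = m i • b i) (π : L →ₗ⁅ℝ⁆ L)
    (hπ₀ : ∀ i, m i = 0 → π (b i) = b i) (hπ : ∀ i, m i ≠ 0 → π (b i) = 0)
    {k : ℕ} {ω : Cochain L k} (hω : ω ∈ cocycles L k) :
    ω - pullback π k ω ∈ coboundaries L k := by
  cases k with
  | zero =>
    have h : pullback π 0 ω = ω := by
      ext v
      rw [pullback_apply]
      exact congrArg ω (Subsingleton.elim _ _)
    rw [h, sub_self]
    exact zero_mem _
  | succ n =>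
    have hfin := finite_cochain b (n + 1)
    -- The Lie derivative is shown to be bijective on `K`, the cocycles that vanish on the zero
    -- eigenspace.
    let K : Submodule ℝ (Cochain L (n + 1)) :=
      cocycles L (n + 1) ⊓ LinearMap.ker (pullback π (n + 1))
    have hπe : ∀ i, ⁅y, π (b i)⁆ = m i • π (b i) := fun i => by
      by_cases h : m i = 0
      · rw [hπ₀ i h, hb]
      · rw [hπ i h, lie_zero, smul_zero]
    have hππ : ∀ i, π (π (b i)) = π (b i) := fun i => by
      by_cases h : m i = 0
      · rw [hπ₀ i h, hπ₀ i h]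
      · rw [hπ i h, map_zero]
    have hK : ∀ ξ ∈ K, lieDerivative y n ξ ∈ K := fun ξ hξ => by
      refine ⟨lieDerivative_mem_cocycles b y m hb hξ.1, ?_⟩
      refine ext_basis b fun v => ?_
      rw [pullback_apply, lieDerivative_apply_of_eigen y ξ _ (fun i => m (v i)) fun i => hπe _,
        ← pullback_apply, LinearMap.mem_ker.1 hξ.2]
      simp
    have hinj : Function.Injective ((lieDerivative y n).restrict hK) := by
      rw [← LinearMap.ker_eq_bot, LinearMap.ker_eq_bot']
      intro ξ hξ
      have h0 : lieDerivative y n ξ.1 = 0 := congrArg Subtype.val hξ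
      refine Subtype.ext (ext_basis b fun v => ?_)
      have h1 := lieDerivative_apply_of_eigen y ξ.1 _ (fun i => m (v i)) fun i => hb (v i)
      rw [h0, AlternatingMap.zero_apply, zero_eq_neg, mul_eq_zero] at h1
      refine h1.elim (fun hs => ?_) id
      -- Total weight zero forces every weight to be zero, so `π` fixes all the arguments and the
      -- value is that of the pullback, which vanishes.
      rw [Finset.sum_eq_zero_iff_of_nonneg fun i _ => hm _] at hs
      have h2 : pullback π (n + 1) ξ.1 (fun i => b (v i)) = 0 := by
        rw [LinearMap.mem_ker.1 ξ.2.2, AlternatingMap.zero_apply]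
      rw [pullback_apply] at h2
      simpa only [hπ₀ _ (hs _ (Finset.mem_univ _)), ZeroMemClass.coe_zero,
        AlternatingMap.zero_apply] using h2
    have hη : ω - pullback π (n + 1) ω ∈ K := by
      refine ⟨sub_mem hω (pullback_mem_cocycles π hω), ?_⟩
      refine ext_basis b fun v => ?_
      rw [map_sub, AlternatingMap.sub_apply, pullback_apply, pullback_apply, pullback_apply]
      simp [hππ]
    -- Finite dimension turns injectivity into surjectivity: the difference is the Lie derivative of
    -- a cocycle, hence exact.
    obtain ⟨ξ, hξ⟩ := LinearMap.injective_iff_surjective.1 hinj ⟨_, hη⟩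
    have h := lieDerivative_mem_coboundaries y ξ.2.1
    rwa [show lieDerivative y n ξ.1 = ω - pullback π (n + 1) ω from congrArg Subtype.val hξ] at h

theorem nonempty_cohomology_equiv [Finite ι]
    (b : Module.Basis ι ℝ L) (y : L) (m : ι → ℝ)
    (hm : ∀ i, 0 ≤ m i) (hb : ∀ i, ⁅y, b i⁆ = m i • b i) (p : L →ₗ⁅ℝ⁆ L') (j : L' →ₗ⁅ℝ⁆ L)
    (hpj : ∀ x, p (j x) = x) (h₀ : ∀ i, m i = 0 → j (p (b i)) = b i)
    (h : ∀ i, m i ≠ 0 → p (b i) = 0) (k : ℕ) :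
    Nonempty (Cohomology L k ≃ₗ[ℝ] Cohomology L' k) := by
  refine ⟨LinearEquiv.ofLinearMap (cohomologyMap j k) (cohomologyMap p k) ?_ ?_⟩
  · refine Submodule.linearMap_qext _ (LinearMap.ext fun ω => ?_)
    refine congrArg (Submodule.Quotient.mk (p := (coboundaries L' k).submoduleOf (cocycles L' k)))
      (Subtype.ext ?_)
    ext v
    change ω.1 _ = ω.1 _
    exact congrArg ω.1 (funext fun i => hpj _)
  · refine Submodule.linearMap_qext _ (LinearMap.ext fun ω => ?_)
    -- Here the composite is pullback along `j ∘ p`, the projection onto the zero eigenspace.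
    refine ((Submodule.Quotient.eq _).2 ?_).symm
    exact sub_pullback_mem_coboundaries b y m hm hb (j.comp p) h₀
      (fun i hi => by rw [LieHom.comp_apply, h i hi, map_zero]) ω.2

end ChevalleyEilenberg

/-! ### Edges of the reduced graph -/

namespace GraphLie

variable {V : Type*} [LinearOrder V] (G : SimpleGraph V) {s : ℕ} (σ : Fin s → Finset V)

/-- The vertices of `G` that belong to no clique of the family. -/
abbrev uncovered : Set V := {v : V | ∀ m, v ∉ σ m}

/-- The graph `G̃ + s K_1` attached to `G` and the family of cliques `σ`. -/
abbrev reduced : SimpleGraph (uncovered σ ⊕ₗ Fin s) :=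
  addIsolated (G.induce (uncovered σ)) s

variable {G σ}

/-- The added vertices are isolated, so only the induced part carries edges. -/
theorem exists_of_edge_reduced (e : Edge (reduced G σ)) : ∃ u v : uncovered σ,
    e.1.1 = toLex (Sum.inl u) ∧ e.1.2 = toLex (Sum.inl v) ∧ u.1 < v.1 ∧ G.Adj u.1 v.1 := by
  obtain ⟨⟨a, b⟩, hlt, hadj⟩ := e
  obtain ⟨a, rfl⟩ := toLex.surjective a
  obtain ⟨b, rfl⟩ := toLex.surjective b
  rcases a with u | i <;> rcases b with v | j
  · exact ⟨u, v, rfl, rfl, by simpa using hlt, by simpa [addIsolated] using hadj⟩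
  all_goals simp [addIsolated] at hadj

/-- The edge of `G̃ + s K_1` given by an edge of `G` whose ends are both uncovered. -/
def edgeLift (e : Edge G) (h : e.1.1 ∈ uncovered σ ∧ e.1.2 ∈ uncovered σ) : Edge (reduced G σ) :=
  ⟨(toLex (Sum.inl ⟨e.1.1, h.1⟩), toLex (Sum.inl ⟨e.1.2, h.2⟩)),
    by simpa using e.2.1, by simpa [addIsolated] using e.2.2⟩

theorem exists_edgeLift_eq (e : Edge (reduced G σ)) :
    ∃ (f : Edge G) (h : f.1.1 ∈ uncovered σ ∧ f.1.2 ∈ uncovered σ), edgeLift f h = e := by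
  obtain ⟨u, v, hu, hv, hlt, hadj⟩ := exists_of_edge_reduced e
  exact ⟨⟨(u.1, v.1), hlt, hadj⟩, ⟨u.2, v.2⟩, Subtype.ext (Prod.ext hu.symm hv.symm)⟩

/-- The edge of `G` underlying an edge of `G̃ + s K_1`. -/
noncomputable def edgeBase (e : Edge (reduced G σ)) : Edge G := (exists_edgeLift_eq e).choose

theorem edgeBase_mem (e : Edge (reduced G σ)) :
    (edgeBase e).1.1 ∈ uncovered σ ∧ (edgeBase e).1.2 ∈ uncovered σ :=
  (exists_edgeLift_eq e).choose_spec.choose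

theorem edgeLift_edgeBase (e : Edge (reduced G σ)) : edgeLift (edgeBase e) (edgeBase_mem e) = e :=
  (exists_edgeLift_eq e).choose_spec.choose_spec

theorem edgeBase_edgeLift (e : Edge G) (h : e.1.1 ∈ uncovered σ ∧ e.1.2 ∈ uncovered σ) :
    edgeBase (edgeLift e h) = e := by
  have h1 := congrArg Subtype.val (edgeLift_edgeBase (edgeLift e h))
  simp only [edgeLift, Prod.mk.injEq, toLex_inj, Sum.inl.injEq, Subtype.mk.injEq] at h1
  exact Subtype.ext (Prod.ext h1.1 h1.2)

/-! ### The projection to weight zero and its section -/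

namespace GGI

theorem card_singleton_inter_eq_zero {v : V} (h : v ∈ uncovered σ) (k : Fin s) :
    (({v} : Finset V) ∩ σ k).card = 0 := by
  simp [Finset.singleton_inter_of_notMem (h k)]

theorem wt_singleton_eq_zero {v : V} (h : v ∈ uncovered σ) (a : GGI G σ) : wt {v} a = 0 :=
  Finset.sum_eq_zero fun k _ => by simp [card_singleton_inter_eq_zero h k]

variable (G σ)

/-- The projection of `𝓛(G, Σ)` to the coordinates of weight zero. -/
noncomputable def toReduced : GGI G σ →ₗ⁅ℝ⁆ DaniMainkar (reduced G σ) where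
  toFun a := (fun w => Sum.elim (fun v : uncovered σ => a.x v.1) a.y (ofLex w),
    fun e => a.xe (edgeBase e))
  map_add' a b := Prod.ext (funext fun w => by
      obtain ⟨w, rfl⟩ := toLex.surjective w
      cases w <;> rfl) rfl
  map_smul' a b := Prod.ext (funext fun w => by
      obtain ⟨w, rfl⟩ := toLex.surjective w
      cases w <;> rfl) rfl
  -- The weights of uncovered vertices vanish, so at these coordinates only the Dani-Mainkar part of
  -- the bracket survives.
  map_lie' {a b} := Prod.ext (funext fun w => by
      obtain ⟨w, rfl⟩ := toLex.surjective w
      rcases w with v | i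
      · change ⁅a, b⁆.x v.1 = 0
        rw [x_lie, sum_weight, wt_singleton_eq_zero v.2, wt_singleton_eq_zero v.2]
        ring
      · rfl) (funext fun e => by
      obtain ⟨f, h, rfl⟩ := exists_edgeLift_eq e
      change ⁅a, b⁆.xe (edgeBase (edgeLift f h)) = a.x f.1.1 * b.x f.1.2 - a.x f.1.2 * b.x f.1.1
      rw [edgeBase_edgeLift, xe_lie, sum_weight, wt_pair f.2.1.ne, wt_pair f.2.1.ne,
        wt_singleton_eq_zero h.1, wt_singleton_eq_zero h.2, wt_singleton_eq_zero h.1,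
        wt_singleton_eq_zero h.2]
      ring)

open Classical in
/-- The element of `𝓛(G, Σ)` with given coordinates of weight zero. -/
noncomputable def extendByZero (a : DaniMainkar (reduced G σ)) : GGI G σ :=
  (fun v => if h : v ∈ uncovered σ then a.1 (toLex (Sum.inl ⟨v, h⟩)) else 0,
    fun e => if h : e.1.1 ∈ uncovered σ ∧ e.1.2 ∈ uncovered σ then a.2 (edgeLift e h) else 0,
    fun k => a.1 (toLex (Sum.inr k)))

variable {G σ}

theorem x_extendByZero (a : DaniMainkar (reduced G σ)) {v : V} (h : v ∈ uncovered σ) :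
    (extendByZero G σ a).x v = a.1 (toLex (Sum.inl ⟨v, h⟩)) := dif_pos h

theorem x_extendByZero_of_notMem (a : DaniMainkar (reduced G σ)) {v : V} (h : v ∉ uncovered σ) :
    (extendByZero G σ a).x v = 0 := dif_neg h

theorem xe_extendByZero (a : DaniMainkar (reduced G σ)) {e : Edge G}
    (h : e.1.1 ∈ uncovered σ ∧ e.1.2 ∈ uncovered σ) :
    (extendByZero G σ a).xe e = a.2 (edgeLift e h) := dif_pos h

theorem xe_extendByZero_of_not (a : DaniMainkar (reduced G σ)) {e : Edge G}
    (h : ¬(e.1.1 ∈ uncovered σ ∧ e.1.2 ∈ uncovered σ)) :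
    (extendByZero G σ a).xe e = 0 := dif_neg h

variable (G σ)

/-- The inclusion of the subspace of weight zero in `𝓛(G, Σ)`. -/
noncomputable def ofReduced : DaniMainkar (reduced G σ) →ₗ⁅ℝ⁆ GGI G σ where
  toFun := extendByZero G σ
  map_add' a b := ext' (fun v => by
      rw [x_add]
      by_cases h : v ∈ uncovered σ
      · simp only [x_extendByZero _ h]; rfl
      · simp only [x_extendByZero_of_notMem _ h, add_zero]) (fun e => by
      rw [xe_add]
      by_cases h : e.1.1 ∈ uncovered σ ∧ e.1.2 ∈ uncovered σ
      · simp only [xe_extendByZero _ h]; rfl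
      · simp only [xe_extendByZero_of_not _ h, add_zero]) fun k => rfl
  map_smul' t a := ext' (fun v => by
      rw [x_smul]
      by_cases h : v ∈ uncovered σ
      · simp only [x_extendByZero _ h]; rfl
      · simp only [x_extendByZero_of_notMem _ h, mul_zero]) (fun e => by
      rw [xe_smul]
      by_cases h : e.1.1 ∈ uncovered σ ∧ e.1.2 ∈ uncovered σ
      · simp only [xe_extendByZero _ h]; rfl
      · simp only [xe_extendByZero_of_not _ h, mul_zero]) fun k => rfl
  map_lie' {a b} := ext' (fun v => by
      rw [x_lie, sum_weight]
      by_cases h : v ∈ uncovered σ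
      · simp only [x_extendByZero _ h, wt_singleton_eq_zero h, mul_zero, zero_mul, sub_zero]; rfl
      · simp only [x_extendByZero_of_notMem _ h, mul_zero, zero_mul, sub_zero]) (fun e => by
      rw [xe_lie, sum_weight, wt_pair e.2.1.ne, wt_pair e.2.1.ne]
      by_cases h : e.1.1 ∈ uncovered σ ∧ e.1.2 ∈ uncovered σ
      · simp only [xe_extendByZero _ h, x_extendByZero _ h.1, x_extendByZero _ h.2,
          wt_singleton_eq_zero h.1, wt_singleton_eq_zero h.2, mul_zero, zero_mul, sub_zero,
          add_zero]
        rfl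
      · simp only [xe_extendByZero_of_not _ h, mul_zero, zero_mul, sub_zero, add_zero]
        -- A covered end has coordinate zero in both elements, which kills both products.
        rcases not_and_or.1 h with h | h <;>
          simp only [x_extendByZero_of_notMem _ h, mul_zero, zero_mul, sub_zero])
      fun k => rfl

variable {G σ}

theorem toReduced_ofReduced (a : DaniMainkar (reduced G σ)) :
    toReduced G σ (ofReduced G σ a) = a :=
  Prod.ext (funext fun w => by
    obtain ⟨w, rfl⟩ := toLex.surjective w
    rcases w with v | i
    · exact dif_pos v.2
    · rfl) (funext fun e => (dif_pos (edgeBase_mem e)).trans (by rw [edgeLift_edgeBase]))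

theorem xe_ofReduced_toReduced (a : GGI G σ) {e : Edge G}
    (h : e.1.1 ∈ uncovered σ ∧ e.1.2 ∈ uncovered σ) :
    (ofReduced G σ (toReduced G σ a)).xe e = a.xe e :=
  (xe_extendByZero _ h).trans (congrArg a.xe (edgeBase_edgeLift e h))

theorem ofReduced_toReduced {a : GGI G σ} (hx : ∀ v ∉ uncovered σ, a.x v = 0)
    (hxe : ∀ e : Edge G, ¬(e.1.1 ∈ uncovered σ ∧ e.1.2 ∈ uncovered σ) → a.xe e = 0) :
    ofReduced G σ (toReduced G σ a) = a :=
  ext' (fun v => by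
    by_cases h : v ∈ uncovered σ
    · exact x_extendByZero _ h
    · exact (x_extendByZero_of_notMem _ h).trans (hx v h).symm) (fun e => by
    by_cases h : e.1.1 ∈ uncovered σ ∧ e.1.2 ∈ uncovered σ
    · exact xe_ofReduced_toReduced a h
    · exact (xe_extendByZero_of_not _ h).trans (hxe e h).symm) fun k => rfl

theorem toReduced_eq_zero {a : GGI G σ} (hx : ∀ v ∈ uncovered σ, a.x v = 0)
    (hxe : ∀ e : Edge G, e.1.1 ∈ uncovered σ ∧ e.1.2 ∈ uncovered σ → a.xe e = 0)
    (hy : ∀ k, a.y k = 0) : toReduced G σ a = 0 :=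
  Prod.ext (funext fun w => by
    obtain ⟨w, rfl⟩ := toLex.surjective w
    rcases w with v | k
    · exact hx v.1 v.2
    · exact hy k) (funext fun e => hxe _ (edgeBase_mem e))

/-! ### The grading element and its eigenvalues -/

/-- The element `-∑ y_k`, whose adjoint action is diagonal with nonnegative eigenvalues. -/
def grading : GGI G σ := ((0, 0, fun _ => -1) : (V → ℝ) × (Edge G → ℝ) × (Fin s → ℝ))

/-- The number of members of the family that contain `v`. -/
noncomputable def mult (σ : Fin s → Finset V) (v : V) : ℝ :=
  ∑ k, ((({v} : Finset V) ∩ σ k).card : ℝ)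

theorem mult_nonneg (v : V) : 0 ≤ mult σ v := Finset.sum_nonneg fun _ _ => Nat.cast_nonneg _

theorem mult_eq_zero_iff {v : V} : mult σ v = 0 ↔ v ∈ uncovered σ := by
  rw [mult, Finset.sum_eq_zero_iff_of_nonneg fun _ _ => Nat.cast_nonneg _]
  simp [uncovered, Finset.singleton_inter]

/-- Nonnegativity rules out cancellation between the two ends of an edge. -/
theorem mult_add_mult_eq_zero_iff {v w : V} :
    mult σ v + mult σ w = 0 ↔ v ∈ uncovered σ ∧ w ∈ uncovered σ := by
  rw [add_eq_zero_iff_of_nonneg (mult_nonneg v) (mult_nonneg w), mult_eq_zero_iff,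
    mult_eq_zero_iff]

theorem wt_grading (v : V) : wt {v} (grading : GGI G σ) = -mult σ v := by
  rw [wt, mult, ← Finset.sum_neg_distrib]
  exact Finset.sum_congr rfl fun k _ => mul_neg_one _

theorem x_grading_lie (a : GGI G σ) (v : V) : ⁅(grading : GGI G σ), a⁆.x v = mult σ v * a.x v := by
  rw [x_lie, sum_weight, wt_grading]
  change 0 * _ - _ = _
  ring

theorem xe_grading_lie (a : GGI G σ) (e : Edge G) :
    ⁅(grading : GGI G σ), a⁆.xe e = (mult σ e.1.1 + mult σ e.1.2) * a.xe e := by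
  rw [xe_lie, sum_weight, wt_pair e.2.1.ne, wt_pair e.2.1.ne, wt_grading, wt_grading]
  change 0 * _ - 0 * _ + (0 * _ - _) = _
  ring

variable (G σ) in
/-- The eigenvalues of `grading` on the basis vectors. -/
noncomputable def eigenvalue : V ⊕ Edge G ⊕ Fin s → ℝ :=
  Sum.elim (mult σ) (Sum.elim (fun e => mult σ e.1.1 + mult σ e.1.2) fun _ => 0)

theorem eigenvalue_nonneg (i : V ⊕ Edge G ⊕ Fin s) : 0 ≤ eigenvalue G σ i := by
  rcases i with v | e | k
  · exact mult_nonneg v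
  · exact add_nonneg (mult_nonneg _) (mult_nonneg _)
  · exact le_rfl

/-! ### The standard basis as an eigenbasis -/

variable [Fintype V]

variable (G σ) in
/-- The basis `x_i`, `x_{i,j}`, `y_k` of `𝓛(G, Σ)`. -/
noncomputable def stdBasis : Module.Basis (V ⊕ Edge G ⊕ Fin s) ℝ (GGI G σ) :=
  haveI := Fintype.ofFinite (Edge G)
  ((Pi.basisFun ℝ V).prod ((Pi.basisFun ℝ (Edge G)).prod (Pi.basisFun ℝ (Fin s))) :
    Module.Basis _ ℝ ((V → ℝ) × (Edge G → ℝ) × (Fin s → ℝ)))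

theorem stdBasis_inl (v : V) :
    stdBasis G σ (Sum.inl v) = ((Pi.single v 1, 0, 0) : (V → ℝ) × (Edge G → ℝ) × (Fin s → ℝ)) := by
  refine (Module.Basis.prod_apply ..).trans ?_
  simp
  rfl

open Classical in
theorem stdBasis_inr_inl (e : Edge G) : stdBasis G σ (Sum.inr (Sum.inl e)) =
    ((0, Pi.single e 1, 0) : (V → ℝ) × (Edge G → ℝ) × (Fin s → ℝ)) := by
  refine (Module.Basis.prod_apply ..).trans ?_
  simp

theorem stdBasis_inr_inr (k : Fin s) : stdBasis G σ (Sum.inr (Sum.inr k)) =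
    ((0, 0, Pi.single k 1) : (V → ℝ) × (Edge G → ℝ) × (Fin s → ℝ)) := by
  refine (Module.Basis.prod_apply ..).trans ?_
  simp

open Classical in
theorem x_stdBasis_inl (v w : V) :
    (stdBasis G σ (Sum.inl v)).x w = if w = v then 1 else 0 := by
  rw [stdBasis_inl]; exact Pi.single_apply ..

theorem xe_stdBasis_inl (v : V) (e : Edge G) : (stdBasis G σ (Sum.inl v)).xe e = 0 := by
  rw [stdBasis_inl]; rfl

theorem y_stdBasis_inl (v : V) (k : Fin s) : (stdBasis G σ (Sum.inl v)).y k = 0 := by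
  rw [stdBasis_inl]; rfl

theorem x_stdBasis_inr_inl (e : Edge G) (w : V) :
    (stdBasis G σ (Sum.inr (Sum.inl e))).x w = 0 := by
  rw [stdBasis_inr_inl]; rfl

open Classical in
theorem xe_stdBasis_inr_inl (e f : Edge G) :
    (stdBasis G σ (Sum.inr (Sum.inl e))).xe f = if f = e then 1 else 0 := by
  rw [stdBasis_inr_inl]; exact Pi.single_apply ..

theorem y_stdBasis_inr_inl (e : Edge G) (k : Fin s) :
    (stdBasis G σ (Sum.inr (Sum.inl e))).y k = 0 := by
  rw [stdBasis_inr_inl]; rfl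

theorem x_stdBasis_inr_inr (k : Fin s) (w : V) :
    (stdBasis G σ (Sum.inr (Sum.inr k))).x w = 0 := by
  rw [stdBasis_inr_inr]; rfl

theorem xe_stdBasis_inr_inr (k : Fin s) (e : Edge G) :
    (stdBasis G σ (Sum.inr (Sum.inr k))).xe e = 0 := by
  rw [stdBasis_inr_inr]; rfl

theorem grading_lie_stdBasis (i : V ⊕ Edge G ⊕ Fin s) :
    ⁅(grading : GGI G σ), stdBasis G σ i⁆ = eigenvalue G σ i • stdBasis G σ i := by
  refine ext' (fun w => ?_) (fun f => ?_) (fun l => ?_)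
  · rw [x_grading_lie, x_smul]
    rcases i with v | e | k
    · rw [x_stdBasis_inl]
      split_ifs with h
      · rw [h]; rfl
      · rw [mul_zero, mul_zero]
    · rw [x_stdBasis_inr_inl, mul_zero, mul_zero]
    · rw [x_stdBasis_inr_inr, mul_zero, mul_zero]
  · rw [xe_grading_lie, xe_smul]
    rcases i with v | e | k
    · rw [xe_stdBasis_inl, mul_zero, mul_zero]
    · rw [xe_stdBasis_inr_inl]
      split_ifs with h
      · rw [h]; rfl
      · rw [mul_zero, mul_zero]
    · rw [xe_stdBasis_inr_inr, mul_zero, mul_zero]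
  · rw [y_lie, y_smul]
    rcases i with v | e | k
    · rw [y_stdBasis_inl, mul_zero]
    · rw [y_stdBasis_inr_inl, mul_zero]
    · exact (zero_mul _).symm

theorem ofReduced_toReduced_stdBasis (i : V ⊕ Edge G ⊕ Fin s) (h : eigenvalue G σ i = 0) :
    ofReduced G σ (toReduced G σ (stdBasis G σ i)) = stdBasis G σ i := by
  rcases i with v | e | k
  · refine ofReduced_toReduced (fun w hw => ?_) fun f _ => xe_stdBasis_inl v f
    rw [x_stdBasis_inl, if_neg]
    rintro rfl
    exact hw (mult_eq_zero_iff.1 h)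
  · refine ofReduced_toReduced (fun w _ => x_stdBasis_inr_inl e w) fun f hf => ?_
    rw [xe_stdBasis_inr_inl, if_neg]
    rintro rfl
    exact hf (mult_add_mult_eq_zero_iff.1 h)
  · exact ofReduced_toReduced (fun w _ => x_stdBasis_inr_inr k w)
      fun f _ => xe_stdBasis_inr_inr k f

theorem toReduced_stdBasis (i : V ⊕ Edge G ⊕ Fin s) (h : eigenvalue G σ i ≠ 0) :
    toReduced G σ (stdBasis G σ i) = 0 := by
  rcases i with v | e | k
  · refine toReduced_eq_zero (fun w hw => ?_) (fun f _ => xe_stdBasis_inl v f) (y_stdBasis_inl v)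
    rw [x_stdBasis_inl, if_neg]
    rintro rfl
    exact h (mult_eq_zero_iff.2 hw)
  · refine toReduced_eq_zero (fun w _ => x_stdBasis_inr_inl e w) (fun f hf => ?_)
      (y_stdBasis_inr_inl e)
    rw [xe_stdBasis_inr_inl, if_neg]
    rintro rfl
    exact h (mult_add_mult_eq_zero_iff.2 hf)
  -- The eigenvalue at `y_k` is zero by definition, so this case is void.
  · exact absurd rfl h

end GGI

end GraphLie

theorem mainTheorem2 {V : Type*} [Fintype V] [LinearOrder V] (G : SimpleGraph V)
    {s : ℕ} (σ : Fin s → Finset V) (hσ : ∀ m, G.IsClique (σ m : Set V)) (k : ℕ) :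
    Nonempty (ChevalleyEilenberg.Cohomology (GraphLie.GGI G σ) k ≃ₗ[ℝ]
      ChevalleyEilenberg.Cohomology
        (GraphLie.DaniMainkar
          (GraphLie.addIsolated (G.induce {v : V | ∀ m, v ∉ σ m}) s)) k) :=
  ChevalleyEilenberg.nonempty_cohomology_equiv (GraphLie.GGI.stdBasis G σ) GraphLie.GGI.grading
    (GraphLie.GGI.eigenvalue G σ) GraphLie.GGI.eigenvalue_nonneg
    GraphLie.GGI.grading_lie_stdBasis (GraphLie.GGI.toReduced G σ) (GraphLie.GGI.ofReduced G σ)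
    GraphLie.GGI.toReduced_ofReduced GraphLie.GGI.ofReduced_toReduced_stdBasis
    GraphLie.GGI.toReduced_stdBasis k
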